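/- Let $\kappa$ be a field of characteristic $0$ and, for $n\in\mathbb Z$, let $P_n\in\kappa[X]$ be the polynomials determined by $P_0=0$, $P_1=1$ and $2X P_n=P_{n-1}+P_{n+1}$. Let $r,s,t>1$ be integers and let $G=C_r\star C_s\star C_t$ be the free product of cyclic groups of orders $r,s,t$. Let $\mathbb F$ be any field extension of $\kappa$ with elements $\mu_1,\mu_2,\mu_3,s_1,s_2,s_3\in\mathbb F$ such that $P_r(\mu_1)=P_s(\mu_2)=P_t(\mu_3)=0$ and $s_i^2+\mu_i^2=1$ for $i=1,2,3$. Put $$A=\mathbb F[x,y,u,v]/\langle(1-x^2)(1-y^2)-(u^2+v^2)\rangle,$$ let $J\lhd A$ be the ideal generated by $u,\ v,\ 1-x^2,\ 1-y^2$, and let $$W=-s_1^2s_2s_3\,xy+\mu_1\mu_3s_1s_2\,x+\mu_1\mu_2s_1s_3\,y+s_1^2\mu_2\mu_3\in A,\qquad M=\begin{pmatrix}u&v&1-x^2&0\\-v&u&0&1-x^2\\1-y^2&0&u&-v\\0&1-y^2&v&u\end{pmatrix}.$$ An element $a\in A$ is said to be represented by $M$ if $a=\mathbf q_1^{T}M\mathbf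 q_2$ for some $\mathbf q_1,\mathbf q_2\in A^4$. Consider the statements: **SW1:** No $w\in G$ normally generates $G$ (that is, for no $w\in G$ is the normal closure of $w$ in $G$ equal to $G$). **SW2:** For every $a\in A$ represented by $M$ and every $\alpha\in J$, the elements $a$ and $W+\alpha$ generate a proper ideal of $A$. Then SW2 implies SW1. -/

import Mathlib

open Polynomial

namespace ScottWiegold

noncomputable section

/-- The polynomials `P n`, for `n : ℤ`, determined by `P 0 = 0`, `P 1 = 1` and
`2 X P n = P (n - 1) + P (n + 1)`. They are the Chebyshev polynomials of the second kind with
the index shifted by one; the three lemmas below are the defining properties. -/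
def P (κ : Type*) [CommRing κ] (n : ℤ) : κ[X] := Polynomial.Chebyshev.U κ (n - 1)

theorem P_zero (κ : Type*) [CommRing κ] : P κ 0 = 0 := by
  simp [P]

theorem P_one (κ : Type*) [CommRing κ] : P κ 1 = 1 := by
  simp [P]

theorem P_rec (κ : Type*) [CommRing κ] (n : ℤ) :
    2 * X * P κ n = P κ (n - 1) + P κ (n + 1) := by
  have h := Polynomial.Chebyshev.U_add_two κ (n - 2)
  have e1 : n - 2 + 2 = n := by ring
  have e2 : n - 2 + 1 = n - 1 := by ring
  have e3 : n - 1 - 1 = n - 2 := by ring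
  have e4 : n + 1 - 1 = n := by ring
  rw [e1, e2] at h
  simp only [P, e3, e4, h]
  ring

/-- The free product `C_r ⋆ C_s ⋆ C_t` of cyclic groups of orders `r`, `s`, `t`. -/
abbrev G (r s t : ℕ) : Type :=
  Monoid.Coprod
    (Monoid.Coprod (Multiplicative (ZMod r)) (Multiplicative (ZMod s)))
    (Multiplicative (ZMod t))

/-- `w` normally generates the group `H`: the smallest normal subgroup containing `w` is `H`. -/
def NormallyGenerates {H : Type*} [Group H] (w : H) : Prop :=
  Subgroup.normalClosure {w} = ⊤

/-- The polynomial `(1 - x²)(1 - y²) - (u² + v²)`, where `x, y, u, v` are the variables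
`0, 1, 2, 3`. -/
def relation (F : Type*) [Field F] : MvPolynomial (Fin 4) F :=
  (1 - MvPolynomial.X 0 ^ 2) * (1 - MvPolynomial.X 1 ^ 2)
    - (MvPolynomial.X 2 ^ 2 + MvPolynomial.X 3 ^ 2)

/-- The ring `A = F[x, y, u, v] / ((1 - x²)(1 - y²) - (u² + v²))`. -/
abbrev A (F : Type*) [Field F] : Type _ :=
  MvPolynomial (Fin 4) F ⧸ Ideal.span {relation F}

/-- The class of the variable `x` in `A`. -/
def x (F : Type*) [Field F] : A F := Ideal.Quotient.mk _ (MvPolynomial.X 0)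

/-- The class of the variable `y` in `A`. -/
def y (F : Type*) [Field F] : A F := Ideal.Quotient.mk _ (MvPolynomial.X 1)

/-- The class of the variable `u` in `A`. -/
def u (F : Type*) [Field F] : A F := Ideal.Quotient.mk _ (MvPolynomial.X 2)

/-- The class of the variable `v` in `A`. -/
def v (F : Type*) [Field F] : A F := Ideal.Quotient.mk _ (MvPolynomial.X 3)

/-- The ideal of `A` generated by `u`, `v`, `1 - x²`, `1 - y²`. -/
def J (F : Type*) [Field F] : Ideal (A F) :=
  Ideal.span {u F, v F, 1 - x F ^ 2, 1 - y F ^ 2}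

/-- `W = -s₁²s₂s₃ x y + μ₁μ₃s₁s₂ x + μ₁μ₂s₁s₃ y + s₁²μ₂μ₃`, an element of `A`. -/
def W {F : Type*} [Field F] (μ₁ μ₂ μ₃ s₁ s₂ s₃ : F) : A F :=
  algebraMap F (A F) (-(s₁ ^ 2 * s₂ * s₃)) * x F * y F
    + algebraMap F (A F) (μ₁ * μ₃ * s₁ * s₂) * x F
    + algebraMap F (A F) (μ₁ * μ₂ * s₁ * s₃) * y F
    + algebraMap F (A F) (s₁ ^ 2 * μ₂ * μ₃)

/-- The `4 × 4` matrix `M` over `A`. -/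
def M (F : Type*) [Field F] : Matrix (Fin 4) (Fin 4) (A F) :=
  !![u F,          v F,          1 - x F ^ 2,  0;
     -v F,         u F,          0,            1 - x F ^ 2;
     1 - y F ^ 2,  0,            u F,          -v F;
     0,            1 - y F ^ 2,  v F,          u F]

/-- `a` is represented by the matrix `N` if `a = q₁ᵀ N q₂` for some vectors `q₁, q₂`. -/
def IsRepresentedBy {R : Type*} [CommRing R] (N : Matrix (Fin 4) (Fin 4) R) (a : R) : Prop :=
  ∃ q₁ q₂ : Fin 4 → R, a = q₁ ⬝ᵥ (N.mulVec q₂)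

/-- No single element normally generates `C_r ⋆ C_s ⋆ C_t`. -/
def SW1 (r s t : ℕ) : Prop :=
  ∀ w : G r s t, ¬ NormallyGenerates w

/-- For every `a` represented by `M` and every `α ∈ J`, the elements `a` and `W + α` generate
a proper ideal of `A`. -/
def SW2 {F : Type*} [Field F] (μ₁ μ₂ μ₃ s₁ s₂ s₃ : F) : Prop :=
  ∀ a : A F, IsRepresentedBy (M F) a → ∀ α ∈ J F,
    Ideal.span {a, W μ₁ μ₂ μ₃ s₁ s₂ s₃ + α} ≠ ⊤

end

end ScottWiegold

/-! At each geometric point of `A`, choose `i` with `i² = -1`. The relation makes the matrix with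
rows `(1 - x², u + iv)` and `(u - iv, 1 - y²)` singular, so it is an outer product of `(p, q)` and
`(p', q')`. Send the three generators to 2×2 matrices with diagonals `μ₁ ± s₁i`, `μ₂ ± s₂xi`, `μ₃ ±
s₃yi` and off-diagonal entries `0`, `(s₂p, -s₂p')`, `(s₃q, -s₃q')`. They have determinant 1 and
trace `2μ`, so the equations `P(μ) = 0` make their `r`-, `s`-, `t`-th powers scalar: `G` is
represented modulo scalars.

A word has upper row `(c, zp + wq)` with `c, z, w` in `A[i]` independent of the point. If it
normally generates `G`, it is scalar at no point, since the first generator is not scalar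
(`not_scalar_at_point`). Hence `im c` and the entries of `row · M` have no common zero and generate
the unit ideal.

Modulo `J` the coordinate `c` is multiplicative. Once the exponent sums are normalized to 1 modulo
the orders (`exists_normalized_word`), `s₁ · im c` is `±W` there (`exists_sign_mul_im_eq`). So some
`W + α` and some represented `a` generate `A`, contradicting SW2. -/

namespace ScottWiegold

/-! ### Chebyshev recursion and powers of elements with a quadratic equation -/

section Chebyshev

variable {F : Type*} [Field F]

theorem eval_P_add_one (μ : F) (n : ℤ) :
    (P F (n + 1)).eval μ = 2 * μ * (P F n).eval μ - (P F (n - 1)).eval μ := by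
  have h := congrArg (Polynomial.eval μ) (P_rec F n)
  simp only [eval_mul, eval_add, eval_X, eval_ofNat] at h
  linear_combination -h

/-- This quadratic form in consecutive values is invariant under the recursion. At a root of `P n`
it forces the preceding value to be a sign. -/
theorem eval_P_sq_add_sq (μ : F) (n : ℕ) :
    (P F ((n : ℤ) - 1)).eval μ ^ 2 + (P F n).eval μ ^ 2
      - 2 * μ * (P F ((n : ℤ) - 1)).eval μ * (P F n).eval μ = 1 := by
  induction n with
  | zero => simp [P]
  | succ n ih =>
    have h := eval_P_add_one μ n
    push_cast
    rw [add_sub_cancel_right, h]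
    linear_combination ih

/-- The hypothesis is Cayley–Hamilton for trace `2μ` and determinant 1. `S` may be noncommutative,
so this serves matrices as well as elements of `R[i]`. -/
theorem pow_eq_eval_P {S : Type*} [Ring S] [Algebra F S] (μ : F) (c : S)
    (hc : c * c = algebraMap F S (2 * μ) * c - 1) (n : ℕ) :
    c ^ n = algebraMap F S ((P F n).eval μ) * c
      - algebraMap F S ((P F ((n : ℤ) - 1)).eval μ) := by
  induction n with
  | zero => simp [P]
  | succ n ih =>
    have h := eval_P_add_one μ n
    push_cast
    rw [add_sub_cancel_right, h, pow_succ, ih, sub_mul, mul_assoc, hc, map_sub,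
      mul_sub, sub_mul, ← mul_assoc, ← map_mul, mul_one, mul_comm (2 * μ)]
    abel

theorem pow_eq_algebraMap {S : Type*} [Ring S] [Algebra F S] {μ : F} {n : ℕ}
    (hμ : (P F n).eval μ = 0) (c : S) (hc : c * c = algebraMap F S (2 * μ) * c - 1) :
    c ^ n = algebraMap F S (-(P F ((n : ℤ) - 1)).eval μ) := by
  rw [pow_eq_eval_P μ c hc, hμ]
  simp

theorem neg_eval_P_sq {μ : F} {n : ℕ} (hμ : (P F n).eval μ = 0) :
    (-(P F ((n : ℤ) - 1)).eval μ) ^ 2 = 1 := by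
  have h := eval_P_sq_add_sq μ n
  rw [hμ] at h
  linear_combination h

/-- Otherwise `μ = ±1`, where `P n` takes the value `±n`, nonzero in characteristic 0. -/
theorem ne_zero_of_eval_P_eq_zero [CharZero F] {μ σ : F} {n : ℕ} (hn : n ≠ 0)
    (hμ : (P F n).eval μ = 0) (h : σ ^ 2 + μ ^ 2 = 1) : σ ≠ 0 := by
  rintro rfl
  have h1 : μ = 1 ∨ μ = -1 := by
    rw [← mul_self_eq_one_iff]
    linear_combination h
  have hn' : (n : F) ≠ 0 := Nat.cast_ne_zero.mpr hn
  rcases h1 with rfl | rfl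
  · simp [P, hn'] at hμ
  · rw [P, Chebyshev.U_eval_neg_one] at hμ
    simp [hn'] at hμ

end Chebyshev

/-! ### Normal generators and quotients -/

section NormalGeneration

theorem NormallyGenerates.map {H H' : Type*} [Group H] [Group H'] {w : H}
    (hw : NormallyGenerates w) (f : H →* H') (hf : Function.Surjective f) :
    NormallyGenerates (f w) := by
  have h := Subgroup.map_normalClosure {w} f hf
  rw [Set.image_singleton, hw, Subgroup.map_top_of_surjective f hf] at h
  exact h.symm

theorem NormallyGenerates.mem_of_normal {H : Type*} [Group H] {w : H} (hw : NormallyGenerates w)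
    (N : Subgroup H) [N.Normal] (h : w ∈ N) (g : H) : g ∈ N := by
  have h1 : Subgroup.normalClosure {w} ≤ N :=
    Subgroup.normalClosure_le_normal (Set.singleton_subset_iff.mpr h)
  rw [hw] at h1
  exact h1 (Subgroup.mem_top g)

/-- In an abelian target the powers of `f w` form a normal subgroup, whose preimage contains `w`. -/
theorem NormallyGenerates.exists_zpow {H C : Type*} [Group H] [CommGroup C] {w : H}
    (hw : NormallyGenerates w) (f : H →* C) (g : H) : ∃ k : ℤ, f w ^ k = f g :=
  Subgroup.mem_zpowers_iff.mp
    (hw.mem_of_normal ((Subgroup.zpowers (f w)).comap f) (Subgroup.mem_zpowers (f w)) g)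

end NormalGeneration

/-! ### Words in the free product and normalization of exponent sums -/

section Words

open Monoid

variable {C₁ C₂ C₃ : Type*} [CommGroup C₁] [CommGroup C₂] [CommGroup C₃]

/-- The generators of a free product of three cyclic groups. -/
def gen (g₁ : C₁) (g₂ : C₂) (g₃ : C₃) : Fin 3 → Coprod (Coprod C₁ C₂) C₃ :=
  ![Coprod.inl (Coprod.inl g₁), Coprod.inl (Coprod.inr g₂), Coprod.inr g₃]

theorem exists_word {g₁ : C₁} {g₂ : C₂} {g₃ : C₃} (h₁ : ∀ x, x ∈ Submonoid.powers g₁)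
    (h₂ : ∀ x, x ∈ Submonoid.powers g₂) (h₃ : ∀ x, x ∈ Submonoid.powers g₃)
    (g : Coprod (Coprod C₁ C₂) C₃) : ∃ l : List (Fin 3), (l.map (gen g₁ g₂ g₃)).prod = g := by
  have hrep (i : Fin 3) (n : ℕ) :
      ((List.replicate n i).map (gen g₁ g₂ g₃)).prod = gen g₁ g₂ g₃ i ^ n := by
    rw [List.map_replicate, List.prod_replicate]
  induction g using Coprod.induction_on with
  | inl g =>
    induction g using Coprod.induction_on with
    | inl z =>
      obtain ⟨n, rfl⟩ := h₁ z
      exact ⟨List.replicate n 0, by rw [hrep]; simp [gen]⟩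
    | inr z =>
      obtain ⟨n, rfl⟩ := h₂ z
      exact ⟨List.replicate n 1, by rw [hrep]; simp [gen]⟩
    | mul a b ha hb =>
      obtain ⟨l, hl⟩ := ha
      obtain ⟨l', hl'⟩ := hb
      exact ⟨l ++ l', by rw [List.map_append, List.prod_append, hl, hl', map_mul]⟩
  | inr z =>
    obtain ⟨n, rfl⟩ := h₃ z
    exact ⟨List.replicate n 2, by rw [hrep]; simp [gen]⟩
  | mul a b ha hb =>
    obtain ⟨l, hl⟩ := ha
    obtain ⟨l', hl'⟩ := hb
    exact ⟨l ++ l', by rw [List.map_append, List.prod_append, hl, hl']⟩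

/-- The endomorphism of the free product that is a power map on each factor. -/
def powHom (C₁ C₂ C₃ : Type*) [CommGroup C₁] [CommGroup C₂] [CommGroup C₃] (a b c : ℤ) :
    Coprod (Coprod C₁ C₂) C₃ →* Coprod (Coprod C₁ C₂) C₃ :=
  Coprod.lift
    (Coprod.lift ((Coprod.inl.comp Coprod.inl).comp (zpowGroupHom a))
      ((Coprod.inl.comp Coprod.inr).comp (zpowGroupHom b)))
    (Coprod.inr.comp (zpowGroupHom c))

/-- The projection of the free product onto its abelianization. -/
def toProd (C₁ C₂ C₃ : Type*) [CommGroup C₁] [CommGroup C₂] [CommGroup C₃] :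
    Coprod (Coprod C₁ C₂) C₃ →* C₁ × C₂ × C₃ :=
  Coprod.lift (Coprod.lift (MonoidHom.inl C₁ (C₂ × C₃))
    ((MonoidHom.inr C₁ (C₂ × C₃)).comp (MonoidHom.inl C₂ C₃)))
    ((MonoidHom.inr C₁ (C₂ × C₃)).comp (MonoidHom.inr C₂ C₃))

theorem toProd_powHom (a b c : ℤ) (g : Coprod (Coprod C₁ C₂) C₃) :
    toProd C₁ C₂ C₃ (powHom C₁ C₂ C₃ a b c g) =
      ((toProd C₁ C₂ C₃ g).1 ^ a, (toProd C₁ C₂ C₃ g).2.1 ^ b, (toProd C₁ C₂ C₃ g).2.2 ^ c) := by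
  have : (toProd C₁ C₂ C₃).comp (powHom C₁ C₂ C₃ a b c) =
      ((zpowGroupHom a).prodMap ((zpowGroupHom b).prodMap (zpowGroupHom c))).comp
        (toProd C₁ C₂ C₃) := by
    refine Coprod.hom_ext (Coprod.hom_ext ?_ ?_) ?_ <;> ext <;> simp [toProd, powHom]
  exact DFunLike.congr_fun this g

/-- Supplies surjectivity of the power map on a factor: a generator is an `a`-th power, hence so is
everything. -/
theorem exists_zpow_eq {C : Type*} [CommGroup C] {a : ℤ} {e g : C} (h : e ^ a = g)
    (hg : ∀ x, x ∈ Submonoid.powers g) (z : C) : ∃ y : C, y ^ a = z := by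
  obtain ⟨n, rfl⟩ := hg z
  exact ⟨e ^ n, by simp only [← h, ← zpow_natCast, zpow_comm e a]⟩

theorem powHom_surjective {a b c : ℤ} (ha : ∀ z : C₁, ∃ y, y ^ a = z)
    (hb : ∀ z : C₂, ∃ y, y ^ b = z) (hc : ∀ z : C₃, ∃ y, y ^ c = z) :
    Function.Surjective (powHom C₁ C₂ C₃ a b c) := by
  intro g
  change g ∈ (powHom C₁ C₂ C₃ a b c).range
  induction g using Coprod.induction_on with
  | inl g =>
    induction g using Coprod.induction_on with
    | inl z =>
      obtain ⟨y, rfl⟩ := ha z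
      exact ⟨Coprod.inl (Coprod.inl y), by simp [powHom]⟩
    | inr z =>
      obtain ⟨y, rfl⟩ := hb z
      exact ⟨Coprod.inl (Coprod.inr y), by simp [powHom]⟩
    | mul a b ha hb => rw [map_mul]; exact mul_mem ha hb
  | inr z =>
    obtain ⟨y, rfl⟩ := hc z
    exact ⟨Coprod.inr y, by simp [powHom]⟩
  | mul a b ha hb => exact mul_mem ha hb

theorem prod_map_eq_pow_count {C : Type*} [CommMonoid C] (c : Fin 3 → C) (l : List (Fin 3)) :
    (l.map c).prod = c 0 ^ l.count 0 * c 1 ^ l.count 1 * c 2 ^ l.count 2 := by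
  rw [Finset.prod_list_map_count, Finset.prod_subset (Finset.subset_univ _)]
  · simp [Fin.prod_univ_three]
  · intro i _ hi
    simp [List.count_eq_zero_of_not_mem (by simpa using hi)]

theorem exists_eq_one_add_mul {C : Type*} [Group C] {g : C} {k : ℕ} (hn : 1 < orderOf g)
    (h : g ^ k = g) : ∃ a, k = 1 + orderOf g * a := by
  have h1 : k ≡ 1 [MOD orderOf g] := pow_eq_pow_iff_modEq.mp (by rwa [pow_one])
  have hk : 1 ≤ k := by
    by_contra! hk
    obtain rfl : k = 0 := by omega
    simp [Nat.ModEq, Nat.mod_eq_of_lt hn] at h1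
  obtain ⟨a, ha⟩ := (Nat.modEq_iff_dvd' hk).mp h1.symm
  exact ⟨a, by omega⟩

/-- A normal generator may be replaced by one whose exponent sums are `1` modulo the orders of
the generators. -/
theorem exists_normalized_word {g₁ : C₁} {g₂ : C₂} {g₃ : C₃}
    (hg₁ : ∀ x, x ∈ Submonoid.powers g₁) (hg₂ : ∀ x, x ∈ Submonoid.powers g₂)
    (hg₃ : ∀ x, x ∈ Submonoid.powers g₃)
    (hr : 1 < orderOf g₁) (hs : 1 < orderOf g₂) (ht : 1 < orderOf g₃)
    {w : Coprod (Coprod C₁ C₂) C₃} (hw : NormallyGenerates w) :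
    ∃ l : List (Fin 3), NormallyGenerates (l.map (gen g₁ g₂ g₃)).prod ∧
      (∃ a, l.count 0 = 1 + orderOf g₁ * a) ∧ (∃ b, l.count 1 = 1 + orderOf g₂ * b) ∧
      ∃ c, l.count 2 = 1 + orderOf g₃ * c := by
  -- The image of `w` generates the abelianization, so each component has a power equal to the
  -- chosen generator. Applying these three powers factorwise gives a surjective endomorphism, whose
  -- value at `w` is the new normal generator.
  obtain ⟨a, ha⟩ := hw.exists_zpow (toProd C₁ C₂ C₃) (gen g₁ g₂ g₃ 0)
  obtain ⟨b, hb⟩ := hw.exists_zpow (toProd C₁ C₂ C₃) (gen g₁ g₂ g₃ 1)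
  obtain ⟨c, hc⟩ := hw.exists_zpow (toProd C₁ C₂ C₃) (gen g₁ g₂ g₃ 2)
  replace ha : (toProd C₁ C₂ C₃ w).1 ^ a = g₁ := by
    simpa [toProd, gen] using congrArg Prod.fst ha
  replace hb : (toProd C₁ C₂ C₃ w).2.1 ^ b = g₂ := by
    simpa [toProd, gen] using congrArg (fun z => z.2.1) hb
  replace hc : (toProd C₁ C₂ C₃ w).2.2 ^ c = g₃ := by
    simpa [toProd, gen] using congrArg (fun z => z.2.2) hc
  obtain ⟨l, hl⟩ := exists_word hg₁ hg₂ hg₃ (powHom C₁ C₂ C₃ a b c w)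
  have h := congrArg (toProd C₁ C₂ C₃) hl
  rw [toProd_powHom, map_list_prod, List.map_map, prod_map_eq_pow_count, ha, hb, hc] at h
  simp only [toProd, gen, Function.comp_apply, Matrix.cons_val, Coprod.lift_apply_inl,
    Coprod.lift_apply_inr, MonoidHom.inl_apply, MonoidHom.inr_apply, MonoidHom.comp_apply,
    Prod.pow_mk, Prod.mk_mul_mk, one_pow, mul_one, one_mul, Prod.mk.injEq] at h
  refine ⟨l, ?_, exists_eq_one_add_mul hr h.1, exists_eq_one_add_mul hs h.2.1,
    exists_eq_one_add_mul ht h.2.2⟩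
  rw [hl]
  exact hw.map _ (powHom_surjective (exists_zpow_eq ha hg₁) (exists_zpow_eq hb hg₂)
    (exists_zpow_eq hc hg₃))

theorem exists_hom_of_pow_eq_one {C H : Type*} [CommGroup C] [Group H] {g : C}
    (hg : ∀ x, x ∈ Submonoid.powers g) (h : H) (hn : h ^ orderOf g = 1) :
    ∃ f : C →* H, f g = h :=
  ⟨monoidHomOfForallMemZpowers (fun x => Submonoid.powers_le_zpowers g (hg x))
    (orderOf_dvd_of_pow_eq_one hn), monoidHomOfForallMemZpowers_apply_gen _ _⟩

/-- If the generators of the free product are represented in a group modulo its center, and a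
normal generator is represented by a central element, then the representation is trivial. -/
theorem mem_center_of_word_mem_center {g₁ : C₁} {g₂ : C₂} {g₃ : C₃}
    (hg₁ : ∀ x, x ∈ Submonoid.powers g₁) (hg₂ : ∀ x, x ∈ Submonoid.powers g₂)
    (hg₃ : ∀ x, x ∈ Submonoid.powers g₃) {H : Type*} [Group H] (h : Fin 3 → H)
    (h₀ : h 0 ^ orderOf g₁ ∈ Subgroup.center H) (h₁ : h 1 ^ orderOf g₂ ∈ Subgroup.center H)
    (h₂ : h 2 ^ orderOf g₃ ∈ Subgroup.center H) {l : List (Fin 3)}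
    (hl : NormallyGenerates (l.map (gen g₁ g₂ g₃)).prod)
    (hc : (l.map h).prod ∈ Subgroup.center H) (i : Fin 3) : h i ∈ Subgroup.center H := by
  let π := QuotientGroup.mk' (Subgroup.center H)
  have hπ (x : H) : π x = 1 ↔ x ∈ Subgroup.center H := QuotientGroup.eq_one_iff x
  obtain ⟨f₀, hf₀⟩ := exists_hom_of_pow_eq_one hg₁ (π (h 0)) (by rwa [← map_pow, hπ])
  obtain ⟨f₁, hf₁⟩ := exists_hom_of_pow_eq_one hg₂ (π (h 1)) (by rwa [← map_pow, hπ])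
  obtain ⟨f₂, hf₂⟩ := exists_hom_of_pow_eq_one hg₃ (π (h 2)) (by rwa [← map_pow, hπ])
  let ρ : Coprod (Coprod C₁ C₂) C₃ →* H ⧸ Subgroup.center H :=
    Coprod.lift (Coprod.lift f₀ f₁) f₂
  have hρ : ∀ j, ρ (gen g₁ g₂ g₃ j) = π (h j) := by
    intro j
    fin_cases j
    · simpa [ρ, gen] using hf₀
    · simpa [ρ, gen] using hf₁
    · simpa [ρ, gen] using hf₂
  have hw : (l.map (gen g₁ g₂ g₃)).prod ∈ ρ.ker := by
    rw [MonoidHom.mem_ker, map_list_prod, List.map_map,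
      show (⇑ρ ∘ gen g₁ g₂ g₃) = ⇑π ∘ h from funext hρ, ← List.map_map, ← map_list_prod, hπ]
    exact hc
  rw [← hπ, ← hρ]
  exact hl.mem_of_normal ρ.ker hw _

end Words

/-! ### Adjoining a square root of -1 -/

section Gaussian

open QuadraticAlgebra

/-- The ring `R[i]`. -/
abbrev Gaussian (R : Type*) [CommRing R] : Type _ := QuadraticAlgebra R (-1) 0

/-- The ring homomorphism from `R[i]` extending `φ` and sending `i` to `j`. -/
def Gaussian.evalHom {R S : Type*} [CommRing R] [CommRing S] (φ : R →+* S) (j : S)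
    (hj : j * j = -1) : Gaussian R →+* S where
  toFun z := φ z.re + φ z.im * j
  map_one' := by simp
  map_zero' := by simp
  map_add' z w := by simp; ring
  map_mul' z w := by
    simp
    linear_combination (-φ z.im * φ w.im) * hj

theorem Gaussian.evalHom_apply {R S : Type*} [CommRing R] [CommRing S] (φ : R →+* S) (j : S)
    (hj : j * j = -1) (z : Gaussian R) : evalHom φ j hj z = φ z.re + φ z.im * j := rfl

end Gaussian

/-! ### Matrix products in coordinates that avoid `p` and `q` -/

section Twisted

/-- Coordinates `(c, z, w)` for the matrices with first row `(c, z p + w q)`, where `(p, q)` is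
a formal vector whose Gram matrix has entries `X`, `h`, `Y`. -/
structure Twisted (B : Type*) where
  /-- the diagonal entry -/
  c : B
  /-- the coefficient of `p` -/
  z : B
  /-- the coefficient of `q` -/
  w : B

variable {B K : Type*} [CommRing B] [StarRing B] [CommRing K]

/-- The product of matrices, in coordinates. -/
def Twisted.mul (X Y h : B) (a b : Twisted B) : Twisted B where
  c := a.c * b.c - (X * a.z * star b.z + Y * a.w * star b.w + h * a.z * star b.w
    + star h * a.w * star b.z)
  z := a.c * b.z + a.z * star b.c
  w := a.c * b.w + a.w * star b.c

/-- The coordinates of a product. -/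
def Twisted.prod (X Y h : B) (g : Fin 3 → Twisted B) : List (Fin 3) → Twisted B
  | [] => ⟨1, 0, 0⟩
  | i :: l => Twisted.mul X Y h (g i) (Twisted.prod X Y h g l)

/-- The matrix with given coordinates. -/
def Twisted.toMatrix (e : B →+* K) (p q p' q' : K) (a : Twisted B) : Matrix (Fin 2) (Fin 2) K :=
  !![e a.c, e a.z * p + e a.w * q;
    -(e (star a.z) * p' + e (star a.w) * q'), e (star a.c)]

/-- Products of off-diagonal entries involve only `pp'`, `qq'`, `pq'`, `qp'`, which come from `B`;
thus the coordinates are computed once over `B`, while the vectors exist only at points. -/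
theorem Twisted.toMatrix_mul {X Y h : B} (hX : star X = X) (hY : star Y = Y) (e : B →+* K)
    {p q p' q' : K} (h₁ : p * p' = e X) (h₂ : q * q' = e Y) (h₃ : p * q' = e h)
    (h₄ : q * p' = e (star h)) (a b : Twisted B) :
    (mul X Y h a b).toMatrix e p q p' q' =
      a.toMatrix e p q p' q' * b.toMatrix e p q p' q' := by
  ext i j
  fin_cases i <;> fin_cases j
  · simp [toMatrix, mul, Matrix.mul_apply, Fin.sum_univ_two, ← h₁, ← h₂, ← h₃, ← h₄]
    ring
  · simp [toMatrix, mul, Matrix.mul_apply, Fin.sum_univ_two]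
    ring
  · simp [toMatrix, mul, Matrix.mul_apply, Fin.sum_univ_two]
    ring
  · simp [toMatrix, mul, Matrix.mul_apply, Fin.sum_univ_two, hX, hY, ← h₁, ← h₂, ← h₃, ← h₄]
    ring

theorem Twisted.toMatrix_prod {X Y h : B} (hX : star X = X) (hY : star Y = Y) (e : B →+* K)
    {p q p' q' : K} (h₁ : p * p' = e X) (h₂ : q * q' = e Y) (h₃ : p * q' = e h)
    (h₄ : q * p' = e (star h)) (g : Fin 3 → Twisted B) (l : List (Fin 3)) :
    (prod X Y h g l).toMatrix e p q p' q' =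
      (l.map fun i => (g i).toMatrix e p q p' q').prod := by
  induction l with
  | nil =>
    ext i j
    fin_cases i <;> fin_cases j <;> simp [toMatrix, prod]
  | cons i l ih => rw [prod, toMatrix_mul hX hY e h₁ h₂ h₃ h₄, ih, List.map_cons, List.prod_cons]

theorem Twisted.map_prod_c {S : Type*} [CommRing S] {X Y h : B} (f : B →+* S) (hX : f X = 0)
    (hY : f Y = 0) (hh : f h = 0) (hh' : f (star h) = 0) (g : Fin 3 → Twisted B)
    (l : List (Fin 3)) : f (prod X Y h g l).c = (l.map fun i => f (g i).c).prod := by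
  induction l with
  | nil => simp [prod]
  | cons i l ih => simp [prod, mul, hX, hY, hh, hh', ih]

end Twisted

/-- A singular 2×2 matrix is an outer product. The final alternative, all zero or both vectors
nonzero, is what permits cancelling a vector later. -/
theorem exists_rank_one_factorization {K : Type*} [Field K] {a b c d : K} (h : a * d = b * c) :
    ∃ p q p' q' : K, p * p' = b ∧ q * q' = c ∧ p * q' = a ∧ q * p' = d ∧
      ((p = 0 ∧ q = 0 ∧ p' = 0 ∧ q' = 0) ∨ ((p ≠ 0 ∨ q ≠ 0) ∧ (p' ≠ 0 ∨ q' ≠ 0))) := by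
  by_cases ha : a = 0
  · subst ha
    rw [zero_mul, eq_comm, mul_eq_zero] at h
    by_cases hb : b = 0
    · by_cases hc : c = 0
      · by_cases hd : d = 0
        · exact ⟨0, 0, 0, 0, by simp [hb, hc, hd]⟩
        · exact ⟨0, d, 1, 0, by simp [hb, hc, hd]⟩
      · exact ⟨0, 1, d, c, by simp [hb, hc]⟩
    · exact ⟨b, d, 1, 0, by simp [hb, h.resolve_left hb]⟩
  · refine ⟨a, c, b / a, 1, ?_, by simp, by simp, ?_, by simp [ha]⟩
    · field_simp
    · field_simp
      linear_combination -h

theorem not_mem_center_of_diagonal {K : Type*} [Field K] {a d : K} (had : a ≠ d)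
    (g : (Matrix (Fin 2) (Fin 2) K)ˣ) (hg : g.val = !![a, 0; 0, d]) :
    g ∉ Subgroup.center (Matrix (Fin 2) (Fin 2) K)ˣ := by
  intro h
  let n : (Matrix (Fin 2) (Fin 2) K)ˣ :=
    ⟨!![1, 1; 0, 1], !![1, -1; 0, 1], by simp [Matrix.one_fin_two], by simp [Matrix.one_fin_two]⟩
  have h1 := congrArg Units.val (Subgroup.mem_center_iff.mp h n)
  rw [Units.val_mul, Units.val_mul, hg] at h1
  have h2 := congrFun (congrFun h1 0) 1
  simp [n, Matrix.mul_apply, Fin.sum_univ_two] at h2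
  exact had h2.symm

theorem mem_center_of_val_eq_algebraMap {K M : Type*} [CommRing K] [Ring M] [Algebra K M] (g : Mˣ)
    (k : K) (hg : g.val = algebraMap K M k) : g ∈ Subgroup.center Mˣ := by
  rw [Subgroup.mem_center_iff]
  intro n
  ext
  rw [Units.val_mul, Units.val_mul, hg, Algebra.commutes]


/-! ### The projective representation at a point -/

section Representation

open QuadraticAlgebra

variable {F : Type*} [Field F]

theorem matrix_mul_self {K : Type*} [CommRing K] {m c b b' : K}
    (h : m ^ 2 - c ^ 2 + b * b' = 1) :
    !![m + c, b; -b', m - c] * !![m + c, b; -b', m - c] =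
      algebraMap K (Matrix (Fin 2) (Fin 2) K) (2 * m) * !![m + c, b; -b', m - c] - 1 := by
  rw [Algebra.algebraMap_eq_smul_one, smul_mul_assoc, one_mul]
  ext i j
  fin_cases i <;> fin_cases j <;> simp [Matrix.mul_apply, Fin.sum_univ_two]
  · linear_combination -h
  · ring
  · ring
  · linear_combination -h

theorem isUnit_of_mul_self_eq {S : Type*} [Ring S] [Algebra F S] {a : F} {c : S}
    (h : c * c = algebraMap F S a * c - 1) : IsUnit c :=
  ⟨⟨c, algebraMap F S a - c, by rw [mul_sub, h, Algebra.commutes]; abel,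
    by rw [sub_mul, h]; abel⟩, rfl⟩

variable {R : Type*} [CommRing R] [Algebra F R]

theorem Gaussian.algebraMap_eq_mk (a : F) :
    algebraMap F (Gaussian R) a = ⟨algebraMap F R a, 0⟩ := by
  rw [IsScalarTower.algebraMap_apply F R (Gaussian R)]
  rfl

theorem Gaussian.mk_mul_self {μ σ : F} (h : σ ^ 2 + μ ^ 2 = 1) {z : R} (hz : z ^ 2 = 1) :
    (⟨algebraMap F R μ, algebraMap F R σ * z⟩ : Gaussian R) *
        ⟨algebraMap F R μ, algebraMap F R σ * z⟩ =
      algebraMap F (Gaussian R) (2 * μ) * ⟨algebraMap F R μ, algebraMap F R σ * z⟩ - 1 := by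
  have h' := congrArg (algebraMap F R) h
  simp only [map_add, map_pow, map_one] at h'
  rw [Gaussian.algebraMap_eq_mk, map_mul, map_ofNat]
  ext
  · simp only [re_mul, re_sub, re_one]
    linear_combination -h' - algebraMap F R σ ^ 2 * hz
  · simp only [im_mul, im_sub, im_one]
    ring

theorem pow_one_add_mul_eq {n a : ℕ} {c : R} {ε : F}
    (h : c ^ n = algebraMap F R ε) : c ^ (1 + n * a) = algebraMap F R (ε ^ a) * c := by
  rw [pow_add, pow_mul, h, pow_one, map_pow, mul_comm]

/-- The element `1 - x²` of `R[i]`. -/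
def gram (x : R) : Gaussian R := ⟨1 - x ^ 2, 0⟩

theorem star_gram (x : R) : star (gram x) = gram x := by
  ext <;> simp [gram]

/-- The coordinates of the matrices representing the three generators. -/
def twistedGen (x y : R) (μ₁ μ₂ μ₃ s₁ s₂ s₃ : F) : Fin 3 → Twisted (Gaussian R) :=
  ![⟨⟨algebraMap F _ μ₁, algebraMap F _ s₁⟩, 0, 0⟩,
    ⟨⟨algebraMap F _ μ₂, algebraMap F _ s₂ * x⟩, ⟨algebraMap F _ s₂, 0⟩, 0⟩,
    ⟨⟨algebraMap F _ μ₃, algebraMap F _ s₃ * y⟩, 0, ⟨algebraMap F _ s₃, 0⟩⟩]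

/-- The coordinates of the matrix representing a word. -/
def twistedWord (x y u v : R) (μ₁ μ₂ μ₃ s₁ s₂ s₃ : F) (l : List (Fin 3)) : Twisted (Gaussian R) :=
  Twisted.prod (gram x) (gram y) ⟨u, v⟩ (twistedGen x y μ₁ μ₂ μ₃ s₁ s₂ s₃) l

/-- A word with normalized exponent sums has, up to sign, the `i`-component `W / s₁` where
`u`, `v`, `1 - x²`, `1 - y²` vanish. -/
theorem exists_sign_mul_im_eq {S : Type*} [CommRing S] [Algebra F S] {x y u v : R}
    (m : R →+* S) (hm : ∀ a, m (algebraMap F R a) = algebraMap F S a)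
    (hX : m (1 - x ^ 2) = 0) (hY : m (1 - y ^ 2) = 0) (hu : m u = 0) (hv : m v = 0)
    {μ₁ μ₂ μ₃ s₁ s₂ s₃ : F} {r s t : ℕ}
    (hμ₁ : (P F r).eval μ₁ = 0) (hμ₂ : (P F s).eval μ₂ = 0) (hμ₃ : (P F t).eval μ₃ = 0)
    (hs₁ : s₁ ^ 2 + μ₁ ^ 2 = 1) (hs₂ : s₂ ^ 2 + μ₂ ^ 2 = 1) (hs₃ : s₃ ^ 2 + μ₃ ^ 2 = 1)
    (hs₁0 : s₁ ≠ 0) {l : List (Fin 3)} (h₀ : ∃ a, l.count 0 = 1 + r * a) (h₁ : ∃ b, l.count 1 = 1 + s * b)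
    (h₂ : ∃ c, l.count 2 = 1 + t * c) :
    ∃ δ : F, δ ≠ 0 ∧ m (algebraMap F R δ * (twistedWord x y u v μ₁ μ₂ μ₃ s₁ s₂ s₃ l).c.im) =
      m (algebraMap F R (-(s₁ ^ 2 * s₂ * s₃)) * x * y + algebraMap F R (μ₁ * μ₃ * s₁ * s₂) * x
        + algebraMap F R (μ₁ * μ₂ * s₁ * s₃) * y + algebraMap F R (s₁ ^ 2 * μ₂ * μ₃)) := by
  obtain ⟨a, ha⟩ := h₀
  obtain ⟨b, hb⟩ := h₁
  obtain ⟨c, hc⟩ := h₂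
  have hx : m x ^ 2 = 1 := by
    rw [map_sub, map_one, map_pow] at hX
    exact (sub_eq_zero.mp hX).symm
  have hy : m y ^ 2 = 1 := by
    rw [map_sub, map_one, map_pow] at hY
    exact (sub_eq_zero.mp hY).symm
  let f : Gaussian R →+* Gaussian S :=
    Gaussian.evalHom ((algebraMap S (Gaussian S)).comp m) ⟨0, 1⟩
      (by rw [mk_mul_mk]; ext <;> simp)
  have hf (z : Gaussian R) : f z = ⟨m z.re, m z.im⟩ := by
    rw [Gaussian.evalHom_apply]
    ext <;> simp
  have hw : f (twistedWord x y u v μ₁ μ₂ μ₃ s₁ s₂ s₃ l).c = _ :=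
    Twisted.map_prod_c f (by rw [hf]; simp only [gram, hX, map_zero]; rfl)
      (by rw [hf]; simp only [gram, hY, map_zero]; rfl) (by rw [hf, hu, hv]; rfl)
      (by simp only [hf, star_mk, map_add, map_mul, map_neg, hu, hv]; ext <;> simp)
      (twistedGen x y μ₁ μ₂ μ₃ s₁ s₂ s₃) l
  have e₁ := pow_eq_algebraMap hμ₁ _ (Gaussian.mk_mul_self (R := S) hs₁ (one_pow 2))
  have e₂ := pow_eq_algebraMap hμ₂ _ (Gaussian.mk_mul_self (R := S) hs₂ hx)
  have e₃ := pow_eq_algebraMap hμ₃ _ (Gaussian.mk_mul_self (R := S) hs₃ hy)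
  have q₁ := neg_eval_P_sq hμ₁
  have q₂ := neg_eval_P_sq hμ₂
  have q₃ := neg_eval_P_sq hμ₃
  generalize -(P F ((r : ℤ) - 1)).eval μ₁ = ε₁ at e₁ q₁
  generalize -(P F ((s : ℤ) - 1)).eval μ₂ = ε₂ at e₂ q₂
  generalize -(P F ((t : ℤ) - 1)).eval μ₃ = ε₃ at e₃ q₃
  have k₀ : f (twistedGen x y μ₁ μ₂ μ₃ s₁ s₂ s₃ 0).c =
      ⟨algebraMap F S μ₁, algebraMap F S s₁ * 1⟩ := by
    rw [hf]; simp [twistedGen, hm]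
  have k₁ : f (twistedGen x y μ₁ μ₂ μ₃ s₁ s₂ s₃ 1).c =
      ⟨algebraMap F S μ₂, algebraMap F S s₂ * m x⟩ := by
    rw [hf]; simp [twistedGen, hm]
  have k₂ : f (twistedGen x y μ₁ μ₂ μ₃ s₁ s₂ s₃ 2).c =
      ⟨algebraMap F S μ₃, algebraMap F S s₃ * m y⟩ := by
    rw [hf]; simp [twistedGen, hm]
  rw [prod_map_eq_pow_count, ha, hb, hc, k₀, k₁, k₂, pow_one_add_mul_eq e₁,
    pow_one_add_mul_eq e₂, pow_one_add_mul_eq e₃, hf] at hw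
  have hδ : (ε₁ ^ a * ε₂ ^ b * ε₃ ^ c) ^ 2 = 1 := by
    rw [mul_pow, mul_pow, ← pow_mul, ← pow_mul, ← pow_mul, mul_comm a, mul_comm b,
      mul_comm c, pow_mul, pow_mul, pow_mul, q₁, q₂, q₃]
    simp
  generalize ε₁ ^ a = η₁ at hw hδ
  generalize ε₂ ^ b = η₂ at hw hδ
  generalize ε₃ ^ c = η₃ at hw hδ
  have hδ' := congrArg (algebraMap F S) hδ
  simp only [map_pow, map_mul, map_one] at hδ'
  have him := congrArg QuadraticAlgebra.im hw
  simp only [Gaussian.algebraMap_eq_mk, mk_mul_mk] at him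
  -- The `η` product has square 1 and cancels the signs from the full powers; the factor `s₁` turns
  -- the imaginary part of `(μ₁ + s₁i)(μ₂ + s₂xi)(μ₃ + s₃yi)` into `W`.
  refine ⟨s₁ * (η₁ * η₂ * η₃), mul_ne_zero hs₁0 fun h => ?_, ?_⟩
  · rw [h] at hδ
    simp at hδ
  rw [map_mul m, hm, him]
  simp only [map_add, map_mul, hm, map_neg, map_pow]
  linear_combination (algebraMap F S s₁ * (
    algebraMap F S μ₁ * algebraMap F S μ₂ * algebraMap F S s₃ * m y
    + algebraMap F S μ₁ * algebraMap F S s₂ * m x * algebraMap F S μ₃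
    + algebraMap F S s₁ * algebraMap F S μ₂ * algebraMap F S μ₃
    - algebraMap F S s₁ * algebraMap F S s₂ * m x * algebraMap F S s₃ * m y)) * hδ'

/-- The row vector of real and imaginary parts of the coordinates of a twisted matrix. -/
def Twisted.row (a : Twisted (Gaussian R)) : Fin 4 → R :=
  ![a.z.re, a.z.im, a.w.re, a.w.im]

/-- The matrix `M`, over an arbitrary ring. -/
def pairing (x y u v : R) : Matrix (Fin 4) (Fin 4) R :=
  !![u,         v,         1 - x ^ 2,  0;
     -v,        u,         0,          1 - x ^ 2;
     1 - y ^ 2, 0,         u,          -v;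
     0,         1 - y ^ 2, v,          u]

/-- Combining columns 0 and 1 (resp. 2 and 3) with coefficients `1, i` gives `(zp + wq)q'` (resp.
`(zp + wq)p'`). Since `(p', q')` is nonzero unless everything vanishes, `zp + wq = 0`; coefficients
`1, -i` give the conjugate statement. -/
theorem Twisted.eval_offDiag {K : Type*} [Field K] {x y u v : R} (φ : R →+* K) {i : K}
    (hi : i * i = -1) {p q p' q' : K}
    (h₁ : p * p' = 1 - φ x ^ 2) (h₂ : q * q' = 1 - φ y ^ 2)
    (h₃ : p * q' = φ u + φ v * i) (h₄ : q * p' = φ u - φ v * i)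
    (h : (p = 0 ∧ q = 0 ∧ p' = 0 ∧ q' = 0) ∨ ((p ≠ 0 ∨ q ≠ 0) ∧ (p' ≠ 0 ∨ q' ≠ 0)))
    (a : Twisted (Gaussian R)) (ha : ∀ j, φ (Matrix.vecMul a.row (pairing x y u v) j) = 0) :
    Gaussian.evalHom φ i hi a.z * p + Gaussian.evalHom φ i hi a.w * q = 0 ∧
      Gaussian.evalHom φ i hi (star a.z) * p' + Gaussian.evalHom φ i hi (star a.w) * q' = 0 := by
  rcases h with ⟨rfl, rfl, rfl, rfl⟩ | ⟨hpq, hpq'⟩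
  · simp
  have a₀ := ha 0
  have a₁ := ha 1
  have a₂ := ha 2
  have a₃ := ha 3
  simp [Matrix.vecMul, dotProduct, Fin.sum_univ_four, Twisted.row, pairing] at a₀ a₁ a₂ a₃
  simp only [Gaussian.evalHom_apply, re_star, im_star, map_neg, zero_mul, add_zero]
  have k₁ : (φ a.z.re + φ a.z.im * i) * p + (φ a.w.re + φ a.w.im * i) * q = 0 := by
    rcases hpq' with hp | hq
    · apply (mul_eq_zero.mp _).resolve_right hp
      linear_combination (φ a.z.re + φ a.z.im * i) * h₁ + (φ a.w.re + φ a.w.im * i) * h₄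
        + a₂ + i * a₃ - φ a.w.im * φ v * hi
    · apply (mul_eq_zero.mp _).resolve_right hq
      linear_combination (φ a.z.re + φ a.z.im * i) * h₃ + (φ a.w.re + φ a.w.im * i) * h₂
        + a₀ + i * a₁ + φ a.z.im * φ v * hi
  have k₂ : (φ a.z.re - φ a.z.im * i) * p' + (φ a.w.re - φ a.w.im * i) * q' = 0 := by
    rcases hpq with hp | hq
    · apply (mul_eq_zero.mp _).resolve_right hp
      linear_combination (φ a.z.re - φ a.z.im * i) * h₁ + (φ a.w.re - φ a.w.im * i) * h₃
        + a₂ - i * a₃ - φ a.w.im * φ v * hi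
    · apply (mul_eq_zero.mp _).resolve_right hq
      linear_combination (φ a.z.re - φ a.z.im * i) * h₄ + (φ a.w.re - φ a.w.im * i) * h₂
        + a₀ - i * a₁ + φ a.z.im * φ v * hi
  refine ⟨k₁, ?_⟩
  linear_combination k₂

/-- The matrices representing the generators have trace `2 μ` and determinant `1`. -/
theorem toMatrix_twistedGen_mul_self {K : Type*} [Field K] [Algebra F K] {x y : R} (φ : R →+* K)
    (hφ : ∀ a, φ (algebraMap F R a) = algebraMap F K a) {i : K} (hi : i * i = -1)
    {p q p' q' : K} (hX : p * p' = 1 - φ x ^ 2) (hY : q * q' = 1 - φ y ^ 2)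
    {μ₁ μ₂ μ₃ s₁ s₂ s₃ : F}
    (hs₁ : s₁ ^ 2 + μ₁ ^ 2 = 1) (hs₂ : s₂ ^ 2 + μ₂ ^ 2 = 1) (hs₃ : s₃ ^ 2 + μ₃ ^ 2 = 1)
    (N : Fin 3 → Matrix (Fin 2) (Fin 2) K)
    (hN : ∀ j, N j = (twistedGen x y μ₁ μ₂ μ₃ s₁ s₂ s₃ j).toMatrix
      (Gaussian.evalHom φ i hi) p q p' q') (j : Fin 3) :
    N j * N j = algebraMap F _ (2 * ![μ₁, μ₂, μ₃] j) * N j - 1 := by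
  have halg (μ : F) : algebraMap F (Matrix (Fin 2) (Fin 2) K) (2 * μ) =
      algebraMap K (Matrix (Fin 2) (Fin 2) K) (2 * algebraMap F K μ) := by
    rw [IsScalarTower.algebraMap_apply F K (Matrix (Fin 2) (Fin 2) K), map_mul (algebraMap F K),
      map_ofNat]
  have key {σ μ : F} (h : σ ^ 2 + μ ^ 2 = 1) {c b b' : K} (hcb : c ^ 2 + b * b' = 1)
      (L : Matrix (Fin 2) (Fin 2) K)
      (hL : L = !![algebraMap F K μ + algebraMap F K σ * c * i, algebraMap F K σ * b;
        -(algebraMap F K σ * b'), algebraMap F K μ - algebraMap F K σ * c * i]) :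
      L * L = algebraMap F _ (2 * μ) * L - 1 := by
    have t := congrArg (algebraMap F K) h
    simp only [map_add, map_pow, map_one] at t
    rw [hL, halg]
    exact matrix_mul_self (by
      linear_combination t - (algebraMap F K σ * c) ^ 2 * hi + algebraMap F K σ ^ 2 * hcb)
  fin_cases j
  · refine key hs₁ (c := 1) (b := 0) (b' := 0) (by ring) _ ?_
    rw [hN]
    simp [twistedGen, Twisted.toMatrix, Gaussian.evalHom_apply, hφ, sub_eq_add_neg]
  · refine key hs₂ (c := φ x) (b := p) (b' := p') (by linear_combination hX) _ ?_
    rw [hN]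
    simp [twistedGen, Twisted.toMatrix, Gaussian.evalHom_apply, hφ, sub_eq_add_neg]
  · refine key hs₃ (c := φ y) (b := q) (b' := q') (by linear_combination hY) _ ?_
    rw [hN]
    simp [twistedGen, Twisted.toMatrix, Gaussian.evalHom_apply, hφ, sub_eq_add_neg]

variable {C₁ C₂ C₃ : Type*} [CommGroup C₁] [CommGroup C₂] [CommGroup C₃]

/-- A normal generator is not represented by a scalar matrix at any point. -/
theorem not_scalar_at_point [CharZero F] {g₁ : C₁} {g₂ : C₂} {g₃ : C₃}
    (hg₁ : ∀ x, x ∈ Submonoid.powers g₁) (hg₂ : ∀ x, x ∈ Submonoid.powers g₂)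
    (hg₃ : ∀ x, x ∈ Submonoid.powers g₃) {μ₁ μ₂ μ₃ s₁ s₂ s₃ : F}
    (hμ₁ : (P F (orderOf g₁)).eval μ₁ = 0) (hμ₂ : (P F (orderOf g₂)).eval μ₂ = 0)
    (hμ₃ : (P F (orderOf g₃)).eval μ₃ = 0)
    (hs₁ : s₁ ^ 2 + μ₁ ^ 2 = 1) (hs₂ : s₂ ^ 2 + μ₂ ^ 2 = 1) (hs₃ : s₃ ^ 2 + μ₃ ^ 2 = 1)
    (hs₁0 : s₁ ≠ 0) {l : List (Fin 3)}
    (hl : NormallyGenerates (l.map (gen g₁ g₂ g₃)).prod)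
    {x y u v : R} (hrel : (1 - x ^ 2) * (1 - y ^ 2) = u ^ 2 + v ^ 2)
    {K : Type*} [Field K] [Algebra F K] (φ : R →+* K)
    (hφ : ∀ a, φ (algebraMap F R a) = algebraMap F K a) {i : K} (hi : i * i = -1)
    (hrow : ∀ j, φ (Matrix.vecMul (twistedWord x y u v μ₁ μ₂ μ₃ s₁ s₂ s₃ l).row
      (pairing x y u v) j) = 0)
    (him : φ (twistedWord x y u v μ₁ μ₂ μ₃ s₁ s₂ s₃ l).c.im = 0) : False := by
  have hrel' := congrArg φ hrel
  simp only [map_mul, map_sub, map_one, map_add, map_pow] at hrel'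
  obtain ⟨p, q, p', q', h₁, h₂, h₃, h₄, hpq⟩ :=
    exists_rank_one_factorization (a := φ u + φ v * i) (b := 1 - φ x ^ 2) (c := 1 - φ y ^ 2)
      (d := φ u - φ v * i) (by linear_combination -hrel' - φ v ^ 2 * hi)
  obtain ⟨k₁, k₂⟩ := Twisted.eval_offDiag φ hi h₁ h₂ h₃ h₄ hpq _ hrow
  let N (j : Fin 3) : Matrix (Fin 2) (Fin 2) K :=
    (twistedGen x y μ₁ μ₂ μ₃ s₁ s₂ s₃ j).toMatrix (Gaussian.evalHom φ i hi) p q p' q'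
  have hN := toMatrix_twistedGen_mul_self φ hφ hi h₁ h₂ hs₁ hs₂ hs₃ N (fun _ => rfl)
  choose U hU using fun j => isUnit_of_mul_self_eq (hN j)
  have hpow {g : ℕ} {j : Fin 3} (hg : (P F g).eval (![μ₁, μ₂, μ₃] j) = 0) :
      U j ^ g ∈ Subgroup.center (Matrix (Fin 2) (Fin 2) K)ˣ := by
    refine mem_center_of_val_eq_algebraMap _ (-(P F ((g : ℤ) - 1)).eval (![μ₁, μ₂, μ₃] j)) ?_
    rw [Units.val_pow_eq_pow_val, hU]
    exact pow_eq_algebraMap hg (N j) (hN j)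
  -- The off-diagonal entries vanish, and `im c = 0` makes both diagonal entries equal to `re c`.
  have hword : (l.map U).prod ∈ Subgroup.center (Matrix (Fin 2) (Fin 2) K)ˣ := by
    refine mem_center_of_val_eq_algebraMap _
      (φ (twistedWord x y u v μ₁ μ₂ μ₃ s₁ s₂ s₃ l).c.re) ?_
    rw [← Units.coeHom_apply, map_list_prod, List.map_map,
      show ⇑(Units.coeHom _) ∘ U = N from funext hU,
      ← Twisted.toMatrix_prod (X := gram x) (Y := gram y) (h := ⟨u, v⟩) (star_gram x) (star_gram y)
        (Gaussian.evalHom φ i hi) (by rw [h₁]; simp [Gaussian.evalHom_apply, gram])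
        (by rw [h₂]; simp [Gaussian.evalHom_apply, gram])
        (by rw [h₃]; simp [Gaussian.evalHom_apply])
        (by rw [h₄]; simp [Gaussian.evalHom_apply, sub_eq_add_neg])]
    change (twistedWord x y u v μ₁ μ₂ μ₃ s₁ s₂ s₃ l).toMatrix _ p q p' q' = _
    rw [Twisted.toMatrix, k₁, k₂, neg_zero, Gaussian.evalHom_apply, Gaussian.evalHom_apply, re_star,
      im_star, map_neg, him]
    ext a b
    fin_cases a <;> fin_cases b <;> simp [Matrix.algebraMap_matrix_apply]
  have hcen := mem_center_of_word_mem_center hg₁ hg₂ hg₃ U (hpow hμ₁) (hpow hμ₂) (hpow hμ₃)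
    hl hword 0
  refine not_mem_center_of_diagonal (a := algebraMap F K μ₁ + algebraMap F K s₁ * i)
    (d := algebraMap F K μ₁ - algebraMap F K s₁ * i) ?_ (U 0) ?_ hcen
  · intro h
    have h2 : algebraMap F K (2 * s₁) * i = 0 := by
      rw [map_mul, map_ofNat]
      linear_combination h
    rcases mul_eq_zero.mp h2 with h2 | rfl
    · rw [map_eq_zero] at h2
      simp [hs₁0] at h2
    · simp at hi
  · rw [hU]
    simp [N, twistedGen, Twisted.toMatrix, Gaussian.evalHom_apply, hφ, sub_eq_add_neg]

end Representation

/-! ### From the absence of common zeros to the failure of SW2 -/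

section Conclusion

variable {F : Type*} [Field F] {C₁ C₂ C₃ : Type*} [CommGroup C₁] [CommGroup C₂] [CommGroup C₃]

theorem relation_eq (F : Type*) [Field F] :
    (1 - x F ^ 2) * (1 - y F ^ 2) = u F ^ 2 + v F ^ 2 := by
  have h : (Ideal.Quotient.mk (Ideal.span {relation F})) (relation F) = 0 :=
    Ideal.Quotient.eq_zero_iff_mem.mpr (Ideal.mem_span_singleton_self _)
  exact sub_eq_zero.mp h

theorem not_normallyGenerates [CharZero F] {g₁ : C₁} {g₂ : C₂} {g₃ : C₃}
    (hg₁ : ∀ x, x ∈ Submonoid.powers g₁) (hg₂ : ∀ x, x ∈ Submonoid.powers g₂)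
    (hg₃ : ∀ x, x ∈ Submonoid.powers g₃)
    (hr : 1 < orderOf g₁) (hs : 1 < orderOf g₂) (ht : 1 < orderOf g₃)
    {μ₁ μ₂ μ₃ s₁ s₂ s₃ : F}
    (hμ₁ : (P F (orderOf g₁)).eval μ₁ = 0) (hμ₂ : (P F (orderOf g₂)).eval μ₂ = 0)
    (hμ₃ : (P F (orderOf g₃)).eval μ₃ = 0)
    (hs₁ : s₁ ^ 2 + μ₁ ^ 2 = 1) (hs₂ : s₂ ^ 2 + μ₂ ^ 2 = 1) (hs₃ : s₃ ^ 2 + μ₃ ^ 2 = 1)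
    (h : SW2 μ₁ μ₂ μ₃ s₁ s₂ s₃) (w : Monoid.Coprod (Monoid.Coprod C₁ C₂) C₃) :
    ¬ NormallyGenerates w := by
  intro hw
  have hs₁0 : s₁ ≠ 0 := ne_zero_of_eval_P_eq_zero (by omega) hμ₁ hs₁
  obtain ⟨l, hl, hl₀, hl₁, hl₂⟩ := exists_normalized_word hg₁ hg₂ hg₃ hr hs ht hw
  obtain ⟨δ, hδ0, hδ⟩ := exists_sign_mul_im_eq (F := F) (S := A F ⧸ J F) (x := x F) (y := y F)
    (u := u F) (v := v F) (Ideal.Quotient.mk (J F)) (fun _ => rfl)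
    (Ideal.Quotient.eq_zero_iff_mem.mpr (Ideal.subset_span (by simp)))
    (Ideal.Quotient.eq_zero_iff_mem.mpr (Ideal.subset_span (by simp)))
    (Ideal.Quotient.eq_zero_iff_mem.mpr (Ideal.subset_span (by simp)))
    (Ideal.Quotient.eq_zero_iff_mem.mpr (Ideal.subset_span (by simp)))
    hμ₁ hμ₂ hμ₃ hs₁ hs₂ hs₃ hs₁0 hl₀ hl₁ hl₂
  set T := twistedWord (x F) (y F) (u F) (v F) μ₁ μ₂ μ₃ s₁ s₂ s₃ l
  let cols := Matrix.vecMul T.row (M F)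
  have htop : Ideal.span (insert T.c.im (Set.range cols)) = ⊤ := by
    by_contra hne
    obtain ⟨m, hm, hle⟩ := Ideal.exists_le_maximal _ hne
    -- The algebraic closure of the residue field provides the required `i`.
    let := Ideal.Quotient.field m
    let φ : A F →+* AlgebraicClosure (A F ⧸ m) :=
      (algebraMap (A F ⧸ m) (AlgebraicClosure (A F ⧸ m))).comp (Ideal.Quotient.mk m)
    have hφ0 (z : A F) (hz : z ∈ insert T.c.im (Set.range cols)) : φ z = 0 := by
      have hz' : Ideal.Quotient.mk m z = 0 :=
        Ideal.Quotient.eq_zero_iff_mem.mpr (hle (Ideal.subset_span hz))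
      rw [RingHom.comp_apply, hz', map_zero]
    let : Algebra F (AlgebraicClosure (A F ⧸ m)) := (φ.comp (algebraMap F (A F))).toAlgebra
    obtain ⟨i, hi⟩ := IsAlgClosed.exists_pow_nat_eq (-1 : AlgebraicClosure (A F ⧸ m)) two_pos
    exact not_scalar_at_point hg₁ hg₂ hg₃ hμ₁ hμ₂ hμ₃ hs₁ hs₂ hs₃ hs₁0 hl (relation_eq F) φ
      (fun _ => rfl) (i := i) (by rw [← hi, sq])
      (fun j => hφ0 _ (Set.mem_insert_of_mem _ ⟨j, rfl⟩)) (hφ0 _ (Set.mem_insert _ _))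
  obtain ⟨b, z, hz, h1⟩ := Ideal.mem_span_insert.mp ((Ideal.eq_top_iff_one _).mp htop)
  obtain ⟨q₂, rfl⟩ := Ideal.mem_span_range_iff_exists_fun.mp hz
  -- Here `a = row · M · q₂`, and `α` is chosen so that `W + α = δ · im c`.
  refine h (∑ j, q₂ j * cols j) ⟨T.row, q₂, ?_⟩
    (algebraMap F (A F) δ * T.c.im - W μ₁ μ₂ μ₃ s₁ s₂ s₃) (Ideal.Quotient.eq.mp hδ) ?_
  · rw [Matrix.dotProduct_mulVec, dotProduct_comm]
    rfl
  · rw [Ideal.eq_top_iff_one, Ideal.mem_span_pair]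
    have hinv : algebraMap F (A F) δ⁻¹ * algebraMap F (A F) δ = 1 := by
      rw [← map_mul, inv_mul_cancel₀ hδ0, map_one]
    refine ⟨1, b * algebraMap F (A F) δ⁻¹, ?_⟩
    rw [add_sub_cancel]
    linear_combination b * T.c.im * hinv - h1

theorem P_eval_of_aeval {κ : Type*} [Field κ] [Algebra κ F] {μ : F} {n : ℤ}
    (h : Polynomial.aeval μ (P κ n) = 0) : (P F n).eval μ = 0 := by
  rwa [P, Chebyshev.aeval_U] at h

theorem orderOf_ofAdd_one (n : ℕ) : orderOf (Multiplicative.ofAdd (1 : ZMod n)) = n := by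
  rw [orderOf_ofAdd_eq_addOrderOf, ZMod.addOrderOf_one]

theorem mem_powers_ofAdd_one {n : ℕ} [NeZero n] (z : Multiplicative (ZMod n)) :
    z ∈ Submonoid.powers (Multiplicative.ofAdd (1 : ZMod n)) :=
  ⟨(Multiplicative.toAdd z).val, by
    change Multiplicative.ofAdd (1 : ZMod n) ^ _ = z
    rw [← ofAdd_nsmul]
    simp⟩

end Conclusion

end ScottWiegold

theorem mainTheorem5 {κ F : Type*} [Field κ] [CharZero κ] [Field F] [Algebra κ F]
    (r s t : ℕ) (hr : 1 < r) (hs : 1 < s) (ht : 1 < t)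
    (μ₁ μ₂ μ₃ s₁ s₂ s₃ : F)
    (hμ₁ : Polynomial.aeval μ₁ (ScottWiegold.P κ r) = 0)
    (hμ₂ : Polynomial.aeval μ₂ (ScottWiegold.P κ s) = 0)
    (hμ₃ : Polynomial.aeval μ₃ (ScottWiegold.P κ t) = 0)
    (hs₁ : s₁ ^ 2 + μ₁ ^ 2 = 1)
    (hs₂ : s₂ ^ 2 + μ₂ ^ 2 = 1)
    (hs₃ : s₃ ^ 2 + μ₃ ^ 2 = 1) :
    ScottWiegold.SW2 μ₁ μ₂ μ₃ s₁ s₂ s₃ → ScottWiegold.SW1 r s t := by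
  intro h w
  have := charZero_of_injective_algebraMap (algebraMap κ F).injective
  have : NeZero r := ⟨by omega⟩
  have : NeZero s := ⟨by omega⟩
  have : NeZero t := ⟨by omega⟩
  have er := ScottWiegold.orderOf_ofAdd_one r
  have es := ScottWiegold.orderOf_ofAdd_one s
  have et := ScottWiegold.orderOf_ofAdd_one t
  have key := ScottWiegold.not_normallyGenerates (ScottWiegold.mem_powers_ofAdd_one (n := r))
    (ScottWiegold.mem_powers_ofAdd_one (n := s)) (ScottWiegold.mem_powers_ofAdd_one (n := t))
    (by rwa [er]) (by rwa [es]) (by rwa [et])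
    (by rw [er]; exact ScottWiegold.P_eval_of_aeval hμ₁)
    (by rw [es]; exact ScottWiegold.P_eval_of_aeval hμ₂)
    (by rw [et]; exact ScottWiegold.P_eval_of_aeval hμ₃) hs₁ hs₂ hs₃ h
  exact key w
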